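/- Let $n\ge 1$ be an integer, let $\mathbb{B}^n=\{z\in\mathbb{C}^n: |z|<1\}$ be the open unit ball for the Euclidean norm, let $dV_N$ be Lebesgue volume measure on $\mathbb{B}^n$ normalized so that $V_N(\mathbb{B}^n)=1$, and let $d(z)$ be the Euclidean distance from $z$ to $\partial\mathbb{B}^n$. Let $\Delta=\sum_{k=1}^n\left(\frac{\partial^2}{\partial x_k^2}+\frac{\partial^2}{\partial y_k^2}\right)$, where $z_k=x_k+iy_k$. For real $\nu>-1$ and $0<\mu<\infty$, the Bergman-type space $b_{\nu,\mu}(\mathbb{B}^n)$ consists of all continuous $f:\mathbb{B}^n\to\mathbb{C}$ with $$\|f\|_{b_{\nu,\mu}}=|f(0)|+\left(\int_{\mathbb{B}^n} d(z)^{\nu}|f(z)|^{\mu}\,dV_N(z)\right)^{1/\mu}<\infty .$$ Let $\tau,\eta:\mathbb{B}^n\to[0,\infty)$ be continuous, and let $f:\mathbb{B}^n\to\mathbb{C}$ be twice continuously differentiable (in the real sense) and satisfy the non-homogeneous Yukawa equation $$\Delta f(z)=\tau(z)f(z)+\eta(z)\,\mathrm{Re}\,f(z)\qquad (z\in\mathbb{B}^n).$$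 Then, for all real $p\ge 2$ and $\alpha\ge 2$, $$\int_{\mathbb{B}^n}(1-|z|^2)^{\alpha}\,\Delta\big(|f(z)|^{p}\big)\,dV_N(z)<\infty$$ (that is, the integrand is integrable on $\mathbb{B}^n$) if and only if $f\in b_{\alpha-2,p}(\mathbb{B}^n)$. -/

import Mathlib

open MeasureTheory Metric Laplacian

noncomputable section

/-- Normalized Lebesgue volume measure of the unit ball of `ℂⁿ`: Lebesgue measure restricted to the
ball and divided by the volume of the ball. -/
def normalizedBallVolume (n : ℕ) : Measure (EuclideanSpace ℂ (Fin n)) :=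
  (volume (ball (0 : EuclideanSpace ℂ (Fin n)) 1))⁻¹ •
    volume.restrict (ball (0 : EuclideanSpace ℂ (Fin n)) 1)

/-- Euclidean distance from `z` to the boundary of the unit ball of `ℂⁿ`. -/
def distToBoundary {n : ℕ} (z : EuclideanSpace ℂ (Fin n)) : ℝ :=
  infDist z (frontier (ball (0 : EuclideanSpace ℂ (Fin n)) 1))

/-- `f` solves the non-homogeneous Yukawa equation `Δ f = τ f + η Re f` in the unit ball.
Here `Δ` is the Laplacian of the real Euclidean space underlying `ℂⁿ`,
that is `∑ₖ (∂²/∂xₖ² + ∂²/∂yₖ²)`. -/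
def SolvesYukawa {n : ℕ} (τ η : EuclideanSpace ℂ (Fin n) → ℝ)
    (f : EuclideanSpace ℂ (Fin n) → ℂ) : Prop :=
  ∀ z ∈ ball (0 : EuclideanSpace ℂ (Fin n)) 1,
    (Δ f) z = (τ z : ℂ) * f z + (η z : ℂ) * ((f z).re : ℂ)

/-- The energy integral `∫ d(z)^ν |f(z)|^μ dV_N(z)` over the unit ball, as an element of `[0, ∞]`. -/
def bergmanEnergy {n : ℕ} (f : EuclideanSpace ℂ (Fin n) → ℂ) (ν μ : ℝ) : ENNReal :=
  ∫⁻ z, ENNReal.ofReal (distToBoundary z ^ ν * ‖f z‖ ^ μ) ∂(normalizedBallVolume n)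

/-- The Bergman-type norm `|f(0)| + (∫ d(z)^ν |f(z)|^μ dV_N(z))^(1/μ)`, in `[0, ∞]`. -/
def bergmanNorm {n : ℕ} (ν μ : ℝ) (f : EuclideanSpace ℂ (Fin n) → ℂ) : ENNReal :=
  ‖f 0‖ₑ + bergmanEnergy f ν μ ^ (1 / μ)

/-- Membership in the Bergman-type space `b_{ν,μ}` of the unit ball (`ν > -1`, `0 < μ < ∞`):
`f` is continuous in the ball and its Bergman-type norm is finite. -/
def MemBergman {n : ℕ} (ν μ : ℝ) (f : EuclideanSpace ℂ (Fin n) → ℂ) : Prop :=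
  ContinuousOn f (ball (0 : EuclideanSpace ℂ (Fin n)) 1) ∧ bergmanNorm ν μ f < ⊤

end

open Topology Filter Asymptotics
open scoped RealInnerProductSpace

/-! ### Regularity of powers of the norm -/

section NormPow

variable {F : Type*} [NormedAddCommGroup F] [InnerProductSpace ℝ F]

/-! Put `u = ‖f‖ ^ p`, which is C² because `p ≥ 2`. The equation gives `⟪f, Δ f⟫ = τ |f|² + η (Re
f)² ≥ 0`, and this makes `u` subharmonic (`laplacian_norm_rpow_nonneg`). From there on only `u ≥ 0`
and `Δ u ≥ 0` matter.

Green's identity with the weight `(r² - ‖z‖²) ^ α`, `r < 1`, which vanishes with its gradient on the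
sphere of radius `r`, moves the Laplacian onto the weight without boundary terms
(`setIntegral_rpow_mul_laplacian`). With `s = r² - ‖z‖²` and `m` the real dimension, the new kernel
is `4α(α-1)‖z‖² s ^ (α-2) - 2αm s ^ (α-1)`. It is at most `4α(α-1) s ^ (α-2)` everywhere, and at
least `s ^ (α-2)` near the unit sphere, uniformly in `r ≥ 1/2`. On the remaining compact ball `u` is
integrable. So the integrals of `s ^ α Δ u` and of `s ^ (α-2) u` control each other uniformly in
`r`, and Fatou's lemma as `r → 1` (`integrableOn_ball_of_setIntegral_le`) gives both implications.
Finally `1 - ‖z‖²` is comparable to `1 - ‖z‖`, the distance to the boundary. -/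

theorem hasFDerivAt_norm_rpow_smul_self {q : ℝ} (hq : 0 < q) (w : F) :
    HasFDerivAt (fun w : F => ‖w‖ ^ q • w)
      (‖w‖ ^ q • ContinuousLinearMap.id ℝ F +
        ((q * ‖w‖ ^ (q - 2)) • innerSL ℝ w).smulRight w) w := by
  rcases eq_or_ne w 0 with rfl | hw
  · have h0 : (‖(0 : F)‖ ^ q • ContinuousLinearMap.id ℝ F +
        ((q * ‖(0 : F)‖ ^ (q - 2)) • innerSL ℝ (0 : F)).smulRight 0) = 0 := by
      ext; simp [Real.zero_rpow hq.ne']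
    rw [h0]
    refine .of_isLittleO ?_
    -- At the origin the map is `o(1)` times `w`, so its derivative is zero.
    have h1 : (fun w : F => ‖w‖ ^ q) =o[𝓝 0] (fun _ => (1 : ℝ)) := by
      refine (isLittleO_const_iff one_ne_zero).mpr ?_
      have := (continuous_norm (E := F)).continuousAt (x := 0) |>.rpow_const (p := q) (.inr hq.le)
      simpa [ContinuousAt, Real.zero_rpow hq.ne'] using this
    simpa using h1.smul_isBigO (isBigO_refl (fun w : F => w) (𝓝 0))
  · have h1 : HasFDerivAt (fun x : F => ‖x‖ ^ q) ((q * ‖w‖ ^ (q - 2)) • innerSL ℝ w) w := by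
      apply HasStrictFDerivAt.hasFDerivAt
      convert! (hasStrictFDerivAt_norm_sq w).rpow_const (p := q / 2) (by simp [hw]) using 0
      simp_rw [← Real.rpow_natCast_mul (norm_nonneg _), ← Nat.cast_smul_eq_nsmul ℝ, smul_smul]
      ring_nf
    exact h1.smul (hasFDerivAt_id w)

theorem contDiff_norm_rpow_smul_self {q : ℝ} (hq : 0 < q) :
    ContDiff ℝ 1 (fun w : F => ‖w‖ ^ q • w) := by
  rw [contDiff_one_iff_fderiv]
  refine ⟨fun w => (hasFDerivAt_norm_rpow_smul_self hq w).differentiableAt, ?_⟩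
  rw [funext fun w => (hasFDerivAt_norm_rpow_smul_self (F := F) hq w).fderiv,
    continuous_iff_continuousAt]
  intro w
  rcases eq_or_ne w 0 with rfl | hw
  · have hlim : Tendsto (fun w : F => (1 + q) * ‖w‖ ^ q) (𝓝 0) (𝓝 0) := by
      have := (continuous_norm (E := F)).continuousAt (x := 0) |>.rpow_const (p := q) (.inr hq.le)
      simpa [ContinuousAt, Real.zero_rpow hq.ne'] using this.const_mul (1 + q)
    have h0 : (‖(0 : F)‖ ^ q • ContinuousLinearMap.id ℝ F +
        ((q * ‖(0 : F)‖ ^ (q - 2)) • innerSL ℝ (0 : F)).smulRight 0) = 0 := by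
      ext; simp [Real.zero_rpow hq.ne']
    rw [ContinuousAt, h0]
    refine squeeze_zero_norm (fun w => ?_) hlim
    refine (norm_add_le _ _).trans ?_
    rw [add_mul, one_mul]
    gcongr
    · rw [norm_smul, Real.norm_of_nonneg (by positivity)]
      exact mul_le_of_le_one_right (by positivity) ContinuousLinearMap.norm_id_le
    · rw [ContinuousLinearMap.norm_smulRight_apply, norm_smul, innerSL_apply_norm,
        Real.norm_of_nonneg (by positivity)]
      rcases eq_or_ne w 0 with rfl | hw
      · simp [Real.zero_rpow hq.ne']
      · have : 0 < ‖w‖ := norm_pos_iff.2 hw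
        rw [Real.rpow_sub this, Real.rpow_two]
        apply le_of_eq
        field_simp
  · have hn : ContinuousAt (fun w : F => ‖w‖) w := continuous_norm.continuousAt
    have h1 : ContinuousAt (fun w : F => ‖w‖ ^ q) w := hn.rpow_const (.inr hq.le)
    have h2 : ContinuousAt (fun w : F => ‖w‖ ^ (q - 2)) w :=
      hn.rpow_const (.inl (norm_ne_zero_iff.2 hw))
    refine (h1.smul continuousAt_const).add ?_
    have h3 : ContinuousAt (fun w : F => (q * ‖w‖ ^ (q - 2)) • innerSL ℝ w) w :=
      (continuousAt_const.mul h2).smul (innerSL ℝ).continuous.continuousAt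
    exact ((ContinuousLinearMap.smulRightL ℝ F F).continuous₂.continuousAt).comp
      (f := fun w : F => ((q * ‖w‖ ^ (q - 2)) • innerSL ℝ w, w)) (h3.prodMk continuousAt_id)

/-- The gradient `p ‖w‖ ^ (p-2) w` is C¹ when `p - 2 > 0`. The case `p = 2` is the smooth squared
norm. -/
theorem contDiff_two_norm_rpow {p : ℝ} (hp : 2 ≤ p) : ContDiff ℝ 2 (fun w : F => ‖w‖ ^ p) := by
  rcases hp.eq_or_lt with rfl | hp
  · simpa using contDiff_norm_sq ℝ (E := F)
  · have h1 : (1 : ℝ) < p := by linarith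
    rw [show (2 : WithTop ℕ∞) = 1 + 1 by norm_num, contDiff_succ_iff_fderiv]
    refine ⟨differentiable_norm_rpow h1, by simp, ?_⟩
    have : fderiv ℝ (fun w : F => ‖w‖ ^ p) =
        fun w => p • innerSL ℝ (‖w‖ ^ (p - 2) • w) := by
      ext1 w
      rw [fderiv_norm_rpow w h1, map_smul, smul_smul]
    rw [this]
    exact ((innerSL ℝ).contDiff.comp
      (contDiff_norm_rpow_smul_self (F := F) (sub_pos.2 hp))).const_smul p

end NormPow

/-! ### Subharmonicity of powers of the norm of `f` -/

section Subharmonic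

variable {E : Type*} [NormedAddCommGroup E] [InnerProductSpace ℝ E] [FiniteDimensional ℝ E]
variable {F : Type*} [NormedAddCommGroup F]

/-- Iterated directional derivatives are the form needed both for chain rules and for integrating by
parts one direction at a time. -/
theorem ContDiffAt.laplacian_eq_sum_fderiv_fderiv [NormedSpace ℝ F] {ι : Type*} [Fintype ι]
    (b : OrthonormalBasis ι ℝ E) {u : E → F} {x : E} (hu : ContDiffAt ℝ 2 u x) :
    (Δ u) x = ∑ i, fderiv ℝ (fun y => fderiv ℝ u y (b i)) x (b i) := by
  rw [InnerProductSpace.laplacian_eq_iteratedFDeriv_orthonormalBasis u b]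
  have hd : DifferentiableAt ℝ (fderiv ℝ u) x :=
    (hu.fderiv_right (m := 1) (by norm_num)).differentiableAt one_ne_zero
  refine Finset.sum_congr rfl fun i _ => ?_
  rw [iteratedFDeriv_two_apply, (hd.hasFDerivAt.clm_apply (hasFDerivAt_const (b i) x)).fderiv]
  simp

theorem ContDiffOn.continuousOn_laplacian [NormedSpace ℝ F] {u : E → F} {s : Set E} (hs : IsOpen s)
    (hu : ContDiffOn ℝ 2 u s) : ContinuousOn (Δ u) s := by
  intro x hx
  rw [InnerProductSpace.laplacian_eq_iteratedFDeriv_stdOrthonormalBasis]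
  have h := (hu.contDiffAt (hs.mem_nhds hx)).iteratedFDeriv_right (m := 0) (i := 2) (by norm_num)
  refine ContinuousAt.continuousWithinAt ?_
  exact tendsto_finsetSum _ fun i _ => by
    have := h.continuousAt
    exact ((ContinuousMultilinearMap.apply ℝ (fun _ : Fin 2 => E) F _).continuous.continuousAt).comp
      this

variable [InnerProductSpace ℝ F]

theorem ContDiffAt.laplacian_norm_sq {f : E → F} {x : E} (hf : ContDiffAt ℝ 2 f x) :
    (Δ (fun y => ‖f y‖ ^ 2)) x =
      2 * ∑ i, ‖fderiv ℝ f x (stdOrthonormalBasis ℝ E i)‖ ^ 2 + 2 * ⟪f x, (Δ f) x⟫ := by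
  set b := stdOrthonormalBasis ℝ E
  rw [(hf.norm_sq ℝ).laplacian_eq_sum_fderiv_fderiv b, hf.laplacian_eq_sum_fderiv_fderiv b,
    inner_sum, Finset.mul_sum, Finset.mul_sum, ← Finset.sum_add_distrib]
  refine Finset.sum_congr rfl fun i _ => ?_
  have hd : DifferentiableAt ℝ (fderiv ℝ f) x :=
    (hf.fderiv_right (m := 1) (by norm_num)).differentiableAt one_ne_zero
  have hdi : DifferentiableAt ℝ (fun y => fderiv ℝ f y (b i)) x :=
    hd.clm_apply (differentiableAt_const _)
  have hfx : DifferentiableAt ℝ f x := hf.differentiableAt two_ne_zero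
  have hev : (fun y => fderiv ℝ (fun y => ‖f y‖ ^ 2) y (b i)) =ᶠ[𝓝 x]
      fun y => 2 * ⟪f y, fderiv ℝ f y (b i)⟫ := by
    filter_upwards [hf.eventually (by simp)] with y hy
    rw [((hy.differentiableAt two_ne_zero).hasFDerivAt.norm_sq).fderiv]
    simp
  rw [hev.fderiv_eq, ((hfx.hasFDerivAt.inner ℝ hdi.hasFDerivAt).const_mul 2).fderiv]
  simp
  ring

theorem ContDiffAt.laplacian_rpow {g : E → ℝ} {x : E} (hg : ContDiffAt ℝ 2 g x) (h0 : g x ≠ 0)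
    (q : ℝ) :
    (Δ (fun y => g y ^ q)) x = q * g x ^ (q - 1) * (Δ g) x +
      q * (q - 1) * g x ^ (q - 2) * ∑ i, (fderiv ℝ g x (stdOrthonormalBasis ℝ E i)) ^ 2 := by
  set b := stdOrthonormalBasis ℝ E
  rw [(hg.rpow_const_of_ne h0).laplacian_eq_sum_fderiv_fderiv b,
    hg.laplacian_eq_sum_fderiv_fderiv b, Finset.mul_sum, Finset.mul_sum, ← Finset.sum_add_distrib]
  refine Finset.sum_congr rfl fun i _ => ?_
  have hd : DifferentiableAt ℝ (fderiv ℝ g) x :=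
    (hg.fderiv_right (m := 1) (by norm_num)).differentiableAt one_ne_zero
  have hdi : DifferentiableAt ℝ (fun y => fderiv ℝ g y (b i)) x :=
    hd.clm_apply (differentiableAt_const _)
  have hgx : DifferentiableAt ℝ g x := hg.differentiableAt two_ne_zero
  have hev : (fun y => fderiv ℝ (fun y => g y ^ q) y (b i)) =ᶠ[𝓝 x]
      fun y => q * g y ^ (q - 1) * fderiv ℝ g y (b i) := by
    filter_upwards [hg.eventually (by simp), hg.continuousAt.eventually_ne h0] with y hy hy0
    rw [((hy.differentiableAt two_ne_zero).hasFDerivAt.rpow_const (.inl hy0)).fderiv]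
    simp
  have h1 := ((hgx.hasFDerivAt.rpow_const (p := q - 1) (.inl h0)).const_mul q).fun_mul hdi.hasFDerivAt
  rw [hev.fderiv_eq, h1.fderiv]
  simp [show q - 1 - 1 = q - 2 by ring]
  ring

/-- Where `f ≠ 0` the chain rule shows the sign. At a zero of `f` it is unavailable; but a negative
Laplacian would stay negative nearby by continuity, forcing `f` to vanish on a neighbourhood, where
the Laplacian is zero. -/
theorem laplacian_norm_rpow_nonneg {f : E → F} {s : Set E} (hs : IsOpen s)
    (hf : ContDiffOn ℝ 2 f s) (hΔ : ∀ x ∈ s, 0 ≤ ⟪f x, (Δ f) x⟫) {p : ℝ} (hp : 2 ≤ p)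
    {x : E} (hx : x ∈ s) : 0 ≤ (Δ (fun y => ‖f y‖ ^ p)) x := by
  have hne : ∀ y ∈ s, f y ≠ 0 → 0 ≤ (Δ (fun y => ‖f y‖ ^ p)) y := by
    intro y hy hfy
    have hfc := hf.contDiffAt (hs.mem_nhds hy)
    -- The base `‖f‖²` is C², unlike `‖f‖`, and its Laplacian is known.
    have heq : (fun y => ‖f y‖ ^ p) = fun y => (‖f y‖ ^ 2) ^ (p / 2) := by
      ext z
      rw [← Real.rpow_natCast_mul (norm_nonneg _)]
      congr 1
      push_cast
      ring
    have hpos : 0 < ‖f y‖ := norm_pos_iff.2 hfy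
    rw [heq, (hfc.norm_sq ℝ).laplacian_rpow (by positivity), hfc.laplacian_norm_sq]
    have h1 : 0 ≤ p / 2 - 1 := by linarith
    have h2 := hΔ y hy
    have h3 : 0 ≤ ∑ i, ‖fderiv ℝ f y (stdOrthonormalBasis ℝ E i)‖ ^ 2 := by positivity
    positivity
  have hcont : ContinuousOn (Δ (fun y => ‖f y‖ ^ p)) s :=
    ((contDiff_two_norm_rpow hp).comp_contDiffOn hf).continuousOn_laplacian hs
  by_contra hneg
  rw [not_le] at hneg
  have hev : ∀ᶠ y in 𝓝 x, f y = 0 := by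
    filter_upwards [(hcont.continuousAt (hs.mem_nhds hx)).eventually_lt_const hneg,
      hs.mem_nhds hx] with y hy hys
    by_contra h
    exact (hne y hys h).not_gt hy
  have h0 : (fun y => ‖f y‖ ^ p) =ᶠ[𝓝 x] fun _ => (0 : ℝ) := by
    filter_upwards [hev] with y hy
    simp [hy, show p ≠ 0 by linarith]
  rw [(InnerProductSpace.laplacian_congr_nhds h0).self_of_nhds] at hneg
  simp at hneg

end Subharmonic

/-! ### Powers of the positive part -/

section PositivePart

theorem hasDerivAt_max_zero_rpow {γ : ℝ} (hγ : 1 < γ) (t : ℝ) :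
    HasDerivAt (fun t : ℝ => max t 0 ^ γ) (γ * max t 0 ^ (γ - 1)) t := by
  rcases lt_trichotomy t 0 with ht | rfl | ht
  · have h1 : (fun t : ℝ => max t 0 ^ γ) =ᶠ[𝓝 t] fun _ => 0 := by
      filter_upwards [gt_mem_nhds ht] with s hs
      rw [max_eq_right hs.le, Real.zero_rpow (by linarith)]
    rw [max_eq_right ht.le, Real.zero_rpow (by linarith), mul_zero]
    exact (hasDerivAt_const t 0).congr_of_eventuallyEq h1
  · have hγ0 : γ ≠ 0 := by linarith
    have hd : (fun t : ℝ => |t| ^ γ) =o[𝓝 0] fun t : ℝ => t := by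
      simpa [Real.zero_rpow hγ0] using (hasDerivAt_abs_rpow 0 hγ).hasFDerivAt.isLittleO
    refine .of_isLittleO ?_
    have hO : (fun t : ℝ => max t 0 ^ γ) =O[𝓝 0] fun t : ℝ => |t| ^ γ := by
      refine .of_bound 1 (.of_forall fun t => ?_)
      rw [one_mul, Real.norm_of_nonneg (by positivity), Real.norm_of_nonneg (by positivity)]
      exact Real.rpow_le_rpow (le_max_right _ _) (max_le (le_abs_self t) (abs_nonneg t))
        (by linarith)
    simpa [Real.zero_rpow hγ0, Real.zero_rpow (sub_ne_zero.2 hγ.ne')] using hO.trans_isLittleO hd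
  · have h1 : (fun t : ℝ => max t 0 ^ γ) =ᶠ[𝓝 t] fun t => t ^ γ := by
      filter_upwards [lt_mem_nhds ht] with s hs
      rw [max_eq_left hs.le]
    rw [max_eq_left ht.le]
    exact (Real.hasDerivAt_rpow_const (.inl ht.ne')).congr_of_eventuallyEq h1

end PositivePart

/-! ### Green's identity with a weight vanishing on the sphere -/

section Green

variable {E : Type*} [NormedAddCommGroup E]

theorem continuous_max_sub_norm_sq_rpow (r : ℝ) {γ : ℝ} (hγ : 0 ≤ γ) :
    Continuous (fun z : E => max (r ^ 2 - ‖z‖ ^ 2) 0 ^ γ) :=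
  Continuous.rpow_const (by fun_prop) fun _ => .inr hγ

theorem max_sub_norm_sq_rpow_eq_zero {r : ℝ} (hr : 0 ≤ r) {γ : ℝ} (hγ : γ ≠ 0) {z : E}
    (hz : z ∉ ball 0 r) : max (r ^ 2 - ‖z‖ ^ 2) 0 ^ γ = 0 := by
  rw [mem_ball_zero_iff, not_lt] at hz
  rw [max_eq_right (by nlinarith), Real.zero_rpow hγ]

variable [InnerProductSpace ℝ E]

theorem hasFDerivAt_max_sub_norm_sq_rpow (r : ℝ) {γ : ℝ} (hγ : 1 < γ) (z : E) :
    HasFDerivAt (fun z : E => max (r ^ 2 - ‖z‖ ^ 2) 0 ^ γ)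
      ((-(2 * γ) * max (r ^ 2 - ‖z‖ ^ 2) 0 ^ (γ - 1)) • innerSL ℝ z) z := by
  have h1 : HasFDerivAt (fun z : E => r ^ 2 - ‖z‖ ^ 2) (-(2 • innerSL ℝ z)) z := by
    simpa using (hasStrictFDerivAt_norm_sq z).hasFDerivAt.const_sub (r ^ 2)
  convert! (hasDerivAt_max_zero_rpow hγ (r ^ 2 - ‖z‖ ^ 2)).comp_hasFDerivAt z h1 using 1
  ext v
  simp
  ring

variable [FiniteDimensional ℝ E] [MeasurableSpace E] [BorelSpace E]
variable (μ : Measure E) [μ.IsAddHaarMeasure]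

theorem integrable_of_continuousOn_closedBall {h : E → ℝ} {r : ℝ}
    (hc : ContinuousOn h (closedBall 0 r)) (h0 : ∀ z ∉ ball 0 r, h z = 0) : Integrable h μ := by
  refine (integrableOn_iff_integrable_of_support_subset (s := closedBall 0 r) fun z hz => ?_).1
    (hc.integrableOn_compact (isCompact_closedBall 0 r))
  by_contra hz'
  exact hz (h0 z fun h => hz' (ball_subset_closedBall h))

/-- Two integrations by parts along `v`. Extended by zero, the weight and its first derivative are
differentiable everywhere since `β - 1 > 1`, so no boundary terms arise. -/
theorem integral_max_sub_norm_sq_rpow_mul_fderiv_fderiv {r : ℝ} (hr0 : 0 ≤ r) (hr1 : r < 1)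
    {u : E → ℝ} (hu : ContDiffOn ℝ 2 u (ball 0 1)) {β : ℝ} (hβ : 2 < β) (v : E) :
    Integrable (fun z => max (r ^ 2 - ‖z‖ ^ 2) 0 ^ β *
        fderiv ℝ (fun y => fderiv ℝ u y v) z v) μ ∧
    Integrable (fun z => (4 * β * (β - 1) * ⟪z, v⟫ ^ 2 * max (r ^ 2 - ‖z‖ ^ 2) 0 ^ (β - 2) -
        2 * β * ‖v‖ ^ 2 * max (r ^ 2 - ‖z‖ ^ 2) 0 ^ (β - 1)) * u z) μ ∧
    ∫ z, max (r ^ 2 - ‖z‖ ^ 2) 0 ^ β * fderiv ℝ (fun y => fderiv ℝ u y v) z v ∂μ =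
      ∫ z, (4 * β * (β - 1) * ⟪z, v⟫ ^ 2 * max (r ^ 2 - ‖z‖ ^ 2) 0 ^ (β - 2) -
        2 * β * ‖v‖ ^ 2 * max (r ^ 2 - ‖z‖ ^ 2) 0 ^ (β - 1)) * u z ∂μ := by
  set φ : ℝ → E → ℝ := fun γ z => max (r ^ 2 - ‖z‖ ^ 2) 0 ^ γ with hφ
  have hsub : closedBall (0 : E) r ⊆ ball 0 1 := closedBall_subset_ball hr1
  have hφc : ∀ γ, 0 ≤ γ → Continuous (φ γ) := fun γ hγ => continuous_max_sub_norm_sq_rpow r hγ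
  have hφ0 : ∀ γ, γ ≠ 0 → ∀ z ∉ ball (0 : E) r, φ γ z = 0 :=
    fun γ hγ z hz => max_sub_norm_sq_rpow_eq_zero hr0 hγ hz
  -- Differentiability of `u` is needed only on the supports of the weights, which lie inside the
  -- unit ball.
  have hts : ∀ g : E → ℝ, (∀ z ∉ ball (0 : E) r, g z = 0) → tsupport g ⊆ ball 0 1 := by
    refine fun g hg => (closure_minimal (fun z hz => ?_) isClosed_closedBall).trans hsub
    by_contra hz'
    exact hz (hg z fun h => hz' (ball_subset_closedBall h))
  set ψ : E → ℝ := fun z => -(2 * β) * φ (β - 1) z * ⟪z, v⟫ with hψ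
  set χ : E → ℝ := fun z => 4 * β * (β - 1) * ⟪z, v⟫ ^ 2 * φ (β - 2) z -
    2 * β * ‖v‖ ^ 2 * φ (β - 1) z with hχ
  have hψ0 : ∀ z ∉ ball (0 : E) r, ψ z = 0 := fun z hz => by
    simp [hψ, hφ0 (β - 1) (by linarith) z hz]
  have hχ0 : ∀ z ∉ ball (0 : E) r, χ z = 0 := fun z hz => by
    simp [hχ, hφ0 (β - 1) (by linarith) z hz, hφ0 (β - 2) (by linarith) z hz]
  have hψc : Continuous ψ := by
    have := hφc (β - 1) (by linarith)
    fun_prop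
  have hχc : Continuous χ := by
    have := hφc (β - 1) (by linarith)
    have := hφc (β - 2) (by linarith)
    fun_prop
  have hφd : ∀ z, HasFDerivAt (φ β) ((-(2 * β) * φ (β - 1) z) • innerSL ℝ z) z :=
    fun z => hasFDerivAt_max_sub_norm_sq_rpow r (by linarith) z
  have hφψ : ∀ z, fderiv ℝ (φ β) z v = ψ z := fun z => by
    rw [(hφd z).fderiv]
    simp [hψ]
  have hψd : ∀ z, HasFDerivAt ψ _ z := fun z =>
    ((hasFDerivAt_max_sub_norm_sq_rpow r (by linarith : 1 < β - 1) z).const_mul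
      (-(2 * β))).fun_mul ((hasFDerivAt_id z).inner ℝ (hasFDerivAt_const v z))
  have hψχ : ∀ z, fderiv ℝ ψ z v = χ z := fun z => by
    rw [(hψd z).fderiv]
    simp [hχ, hφ, show β - 1 - 1 = β - 2 by ring]
    ring
  have hu1 : ContDiffOn ℝ 1 (fderiv ℝ u) (ball 0 1) :=
    hu.fderiv_of_isOpen isOpen_ball (by norm_num)
  have huv : ContDiffOn ℝ 1 (fun z => fderiv ℝ u z v) (ball 0 1) :=
    hu1.clm_apply contDiffOn_const
  have huvd : ∀ z ∈ ball (0 : E) 1, DifferentiableAt ℝ (fun z => fderiv ℝ u z v) z := fun z hz =>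
    (huv.contDiffAt (isOpen_ball.mem_nhds hz)).differentiableAt one_ne_zero
  have hud : ∀ z ∈ ball (0 : E) 1, DifferentiableAt ℝ u z := fun z hz =>
    (hu.contDiffAt (isOpen_ball.mem_nhds hz)).differentiableAt two_ne_zero
  have huvv : ContinuousOn (fun z => fderiv ℝ (fun z => fderiv ℝ u z v) z v) (ball 0 1) :=
    (huv.continuousOn_fderiv_of_isOpen isOpen_ball le_rfl).clm_apply continuousOn_const
  have int : ∀ g h : E → ℝ, Continuous g → (∀ z ∉ ball (0 : E) r, g z = 0) →
      ContinuousOn h (ball 0 1) → Integrable (fun z => g z * h z) μ := fun g h hg hg0 hh =>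
    integrable_of_continuousOn_closedBall μ (hg.continuousOn.mul (hh.mono hsub))
      fun z hz => by simp [hg0 z hz]
  have i1 := int (φ β) _ (hφc β (by linarith)) (hφ0 β (by linarith)) huvv
  have i2 := int (φ β) _ (hφc β (by linarith)) (hφ0 β (by linarith)) huv.continuousOn
  have i3 := int ψ _ hψc hψ0 huv.continuousOn
  have i4 := int ψ _ hψc hψ0 hu.continuousOn
  have i5 := int χ _ hχc hχ0 hu.continuousOn
  refine ⟨i1, i5, ?_⟩
  have s1 := integral_mul_fderiv_eq_neg_fderiv_mul_of_integrable (μ := μ) (f := φ β)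
    (g := fun z => fderiv ℝ u z v) (v := v) (by simpa only [hφψ] using i3) i1 i2
    (fun z _ => (hφd z).differentiableAt)
    (fun z hz => huvd z (hts _ (hφ0 β (by linarith)) hz))
  have s2 := integral_mul_fderiv_eq_neg_fderiv_mul_of_integrable (μ := μ) (f := ψ)
    (g := u) (v := v) (by simpa only [hψχ] using i5) i3 i4
    (fun z _ => (hψd z).differentiableAt)
    (fun z hz => hud z (hts _ hψ0 hz))
  simp only [hφψ] at s1
  simp only [hψχ] at s2
  rw [s1, s2, neg_neg]

theorem setIntegral_rpow_mul_laplacian_of_two_lt {r : ℝ} (hr0 : 0 ≤ r) (hr1 : r < 1)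
    {u : E → ℝ} (hu : ContDiffOn ℝ 2 u (ball 0 1)) {β : ℝ} (hβ : 2 < β) :
    ∫ z in ball 0 r, (r ^ 2 - ‖z‖ ^ 2) ^ β * (Δ u) z ∂μ =
      ∫ z in ball 0 r, (4 * β * (β - 1) * ‖z‖ ^ 2 * (r ^ 2 - ‖z‖ ^ 2) ^ (β - 2) -
        2 * β * Module.finrank ℝ E * (r ^ 2 - ‖z‖ ^ 2) ^ (β - 1)) * u z ∂μ := by
  set b := stdOrthonormalBasis ℝ E with hb
  have hpos : ∀ z ∈ ball (0 : E) r, max (r ^ 2 - ‖z‖ ^ 2) 0 = r ^ 2 - ‖z‖ ^ 2 := fun z hz => by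
    rw [mem_ball_zero_iff] at hz
    exact max_eq_left (by nlinarith [norm_nonneg z])
  have key := fun i => integral_max_sub_norm_sq_rpow_mul_fderiv_fderiv μ hr0 hr1 hu hβ (b i)
  have h1 : ∫ z in ball 0 r, (r ^ 2 - ‖z‖ ^ 2) ^ β * (Δ u) z ∂μ =
      ∫ z, ∑ i, max (r ^ 2 - ‖z‖ ^ 2) 0 ^ β *
        fderiv ℝ (fun y => fderiv ℝ u y (b i)) z (b i) ∂μ := by
    refine Eq.trans ?_ (setIntegral_eq_integral_of_forall_compl_eq_zero (s := ball 0 r)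
      (fun z hz => by
        simp [max_sub_norm_sq_rpow_eq_zero hr0 (show β ≠ 0 by linarith) hz]))
    refine setIntegral_congr_fun measurableSet_ball fun z hz => ?_
    have hz1 : z ∈ ball (0 : E) 1 := ball_subset_ball hr1.le hz
    simp only [hpos z hz]
    rw [← Finset.mul_sum,
      (hu.contDiffAt (isOpen_ball.mem_nhds hz1)).laplacian_eq_sum_fderiv_fderiv b]
  have h2 : ∫ z in ball 0 r, (4 * β * (β - 1) * ‖z‖ ^ 2 * (r ^ 2 - ‖z‖ ^ 2) ^ (β - 2) -
        2 * β * Module.finrank ℝ E * (r ^ 2 - ‖z‖ ^ 2) ^ (β - 1)) * u z ∂μ =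
      ∫ z, ∑ i, (4 * β * (β - 1) * ⟪z, b i⟫ ^ 2 * max (r ^ 2 - ‖z‖ ^ 2) 0 ^ (β - 2) -
        2 * β * ‖b i‖ ^ 2 * max (r ^ 2 - ‖z‖ ^ 2) 0 ^ (β - 1)) * u z ∂μ := by
    -- Since `0 ^ 0 = 1`, vanishing outside the ball requires `β - 2 ≠ 0`.
    refine Eq.trans ?_ (setIntegral_eq_integral_of_forall_compl_eq_zero (s := ball 0 r)
      (fun z hz => by
        simp [max_sub_norm_sq_rpow_eq_zero hr0 (show β - 1 ≠ 0 by linarith) hz,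
          max_sub_norm_sq_rpow_eq_zero hr0 (show β - 2 ≠ 0 by linarith) hz]))
    refine setIntegral_congr_fun measurableSet_ball fun z hz => ?_
    simp only [hpos z hz]
    rw [← Finset.sum_mul, Finset.sum_sub_distrib, ← Finset.sum_mul, ← Finset.mul_sum,
      b.sum_sq_inner_left]
    simp only [b.norm_eq_one, one_pow, mul_one, Finset.sum_const, Finset.card_univ,
      Fintype.card_fin, nsmul_eq_mul]
    ring
  rw [h1, h2, integral_finsetSum _ fun i _ => (key i).1,
    integral_finsetSum _ fun i _ => (key i).2.1]
  exact Finset.sum_congr rfl fun i _ => (key i).2.2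

end Green

/-! ### The endpoint exponent by a limit -/

section Weighted

variable {E : Type*} [NormedAddCommGroup E] [InnerProductSpace ℝ E] [FiniteDimensional ℝ E]
variable [MeasurableSpace E] [BorelSpace E] (μ : Measure E) [μ.IsAddHaarMeasure]

/-- At `α = 2` the second derivative of the weight jumps across the sphere, so the identity is
obtained from exponents `β > α` by dominated convergence as `β ↓ α`. -/
theorem setIntegral_rpow_mul_laplacian {r : ℝ} (hr0 : 0 ≤ r) (hr1 : r < 1)
    {u : E → ℝ} (hu : ContDiffOn ℝ 2 u (ball 0 1)) {α : ℝ} (hα : 2 ≤ α) :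
    ∫ z in ball 0 r, (r ^ 2 - ‖z‖ ^ 2) ^ α * (Δ u) z ∂μ =
      ∫ z in ball 0 r, (4 * α * (α - 1) * ‖z‖ ^ 2 * (r ^ 2 - ‖z‖ ^ 2) ^ (α - 2) -
        2 * α * Module.finrank ℝ E * (r ^ 2 - ‖z‖ ^ 2) ^ (α - 1)) * u z ∂μ := by
  have hsub : closedBall (0 : E) r ⊆ ball 0 1 := closedBall_subset_ball hr1
  have hs : ∀ z ∈ ball (0 : E) r, 0 < r ^ 2 - ‖z‖ ^ 2 ∧ r ^ 2 - ‖z‖ ^ 2 ≤ 1 ∧ ‖z‖ ^ 2 ≤ 1 := by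
    intro z hz
    rw [mem_ball_zero_iff] at hz
    have := norm_nonneg z
    exact ⟨by nlinarith, by nlinarith, by nlinarith⟩
  have hint : ∀ h : E → ℝ, ContinuousOn h (ball 0 1) → IntegrableOn h (ball 0 r) μ := fun h hh =>
    ((hh.mono hsub).integrableOn_compact (isCompact_closedBall 0 r)).mono_set ball_subset_closedBall
  have hpow : ∀ γ : ℝ, ContinuousOn (fun z : E => (r ^ 2 - ‖z‖ ^ 2) ^ γ) (ball 0 r) := fun γ =>
    ContinuousOn.rpow_const (by fun_prop) fun z hz => .inl (hs z hz).1.ne'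
  have hΔ := hu.continuousOn_laplacian isOpen_ball
  have hpow1 : ∀ γ : ℝ, 0 ≤ γ → ∀ z ∈ ball (0 : E) r,
      0 ≤ (r ^ 2 - ‖z‖ ^ 2) ^ γ ∧ (r ^ 2 - ‖z‖ ^ 2) ^ γ ≤ 1 := fun γ hγ z hz =>
    ⟨Real.rpow_nonneg (hs z hz).1.le _, Real.rpow_le_one (hs z hz).1.le (hs z hz).2.1 hγ⟩
  have hI : ∀ᶠ β in 𝓝[>] α, β ∈ Set.Ioo α (α + 1) := Ioo_mem_nhdsGT (by linarith)
  have hcpow : ∀ z ∈ ball (0 : E) r, ∀ c : ℝ,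
      Tendsto (fun β : ℝ => (r ^ 2 - ‖z‖ ^ 2) ^ (β - c)) (𝓝[>] α)
        (𝓝 ((r ^ 2 - ‖z‖ ^ 2) ^ (α - c))) := by
    intro z hz c
    have h : Continuous fun β : ℝ => (r ^ 2 - ‖z‖ ^ 2) ^ (β - c) :=
      Continuous.rpow continuous_const (by fun_prop) fun _ => .inl (hs z hz).1.ne'
    exact (h.tendsto α).mono_left nhdsWithin_le_nhds
  have hid : Tendsto (fun β : ℝ => β) (𝓝[>] α) (𝓝 α) := nhdsWithin_le_nhds
  have t1 : Tendsto (fun β : ℝ => ∫ z in ball 0 r, (r ^ 2 - ‖z‖ ^ 2) ^ β * (Δ u) z ∂μ) (𝓝[>] α)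
      (𝓝 (∫ z in ball 0 r, (r ^ 2 - ‖z‖ ^ 2) ^ α * (Δ u) z ∂μ)) := by
    refine tendsto_integral_filter_of_dominated_convergence (fun z => |(Δ u) z|) ?_ ?_
      (hint _ hΔ.abs) ?_
    · exact .of_forall fun β => ((hpow β).mul (hΔ.mono (ball_subset_closedBall.trans hsub)))
        |>.aestronglyMeasurable measurableSet_ball
    · filter_upwards [hI] with β hβ
      refine (ae_restrict_iff' measurableSet_ball).2 (.of_forall fun z hz => ?_)
      obtain ⟨h0, h1⟩ := hpow1 β (by linarith [hβ.1]) z hz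
      rw [norm_mul, Real.norm_of_nonneg h0, Real.norm_eq_abs]
      exact mul_le_of_le_one_left (abs_nonneg _) h1
    · refine (ae_restrict_iff' measurableSet_ball).2 (.of_forall fun z hz => ?_)
      simpa using (hcpow z hz 0).mul_const ((Δ u) z)
  set m : ℝ := ((Module.finrank ℝ E : ℕ) : ℝ) with hm
  have hm0 : 0 ≤ m := by positivity
  have t2 : Tendsto (fun β : ℝ =>
      ∫ z in ball 0 r, (4 * β * (β - 1) * ‖z‖ ^ 2 * (r ^ 2 - ‖z‖ ^ 2) ^ (β - 2) -
        2 * β * m * (r ^ 2 - ‖z‖ ^ 2) ^ (β - 1)) * u z ∂μ) (𝓝[>] α)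
      (𝓝 (∫ z in ball 0 r, (4 * α * (α - 1) * ‖z‖ ^ 2 * (r ^ 2 - ‖z‖ ^ 2) ^ (α - 2) -
        2 * α * m * (r ^ 2 - ‖z‖ ^ 2) ^ (α - 1)) * u z ∂μ)) := by
    refine tendsto_integral_filter_of_dominated_convergence
      (fun z => (4 * (α + 1) * α + 2 * (α + 1) * m) * |u z|) ?_ ?_
      ((hint _ hu.continuousOn.abs).const_mul _) ?_
    · refine .of_forall fun β => ContinuousOn.aestronglyMeasurable ?_ measurableSet_ball
      have h1 := hpow (β - 2)
      have h2 := hpow (β - 1)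
      have h3 := hu.continuousOn.mono (ball_subset_closedBall.trans hsub)
      fun_prop
    · filter_upwards [hI] with β hβ
      refine (ae_restrict_iff' measurableSet_ball).2 (.of_forall fun z hz => ?_)
      obtain ⟨h0, h1⟩ := hpow1 (β - 2) (by linarith [hβ.1]) z hz
      obtain ⟨h2, h3⟩ := hpow1 (β - 1) (by linarith [hβ.1]) z hz
      have hz2 := (hs z hz).2.2
      rw [norm_mul, Real.norm_eq_abs (u z)]
      refine mul_le_mul_of_nonneg_right ?_ (abs_nonneg _)
      have hβ1 : 0 ≤ β := by linarith [hβ.1]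
      have hβ2 : 0 ≤ β - 1 := by linarith [hβ.1]
      refine (norm_sub_le _ _).trans (add_le_add ?_ ?_)
      · rw [Real.norm_of_nonneg (by positivity), mul_assoc]
        calc 4 * β * (β - 1) * (‖z‖ ^ 2 * (r ^ 2 - ‖z‖ ^ 2) ^ (β - 2))
            ≤ 4 * β * (β - 1) * 1 := by
              gcongr
              exact mul_le_one₀ hz2 h0 h1
          _ ≤ 4 * (α + 1) * α := by
              rw [mul_one]
              exact mul_le_mul (by linarith [hβ.2]) (by linarith [hβ.2]) hβ2 (by linarith)
      · rw [Real.norm_of_nonneg (by positivity)]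
        calc 2 * β * m * (r ^ 2 - ‖z‖ ^ 2) ^ (β - 1) ≤ 2 * β * m * 1 := by gcongr
          _ ≤ 2 * (α + 1) * m := by
              rw [mul_one]
              gcongr
              exact hβ.2.le
    · refine (ae_restrict_iff' measurableSet_ball).2 (.of_forall fun z hz => ?_)
      exact (((((hid.const_mul 4).mul (hid.sub_const 1)).mul_const _).mul (hcpow z hz 2)).sub
        (((hid.const_mul 2).mul_const m).mul (hcpow z hz 1))).mul_const (u z)
  refine tendsto_nhds_unique (t1.congr' ?_) t2
  filter_upwards [hI] with β hβ
  exact setIntegral_rpow_mul_laplacian_of_two_lt μ hr0 hr1 hu (hα.trans_lt hβ.1)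

end Weighted

/-! ### Exhausting the unit ball -/

section Exhaustion

variable {E : Type*} [NormedAddCommGroup E] [NormedSpace ℝ E] [FiniteDimensional ℝ E]
variable [MeasurableSpace E] [BorelSpace E] (μ : Measure E) [μ.IsAddHaarMeasure]

theorem integrableOn_sub_norm_sq_rpow_mul {h : E → ℝ} (hc : ContinuousOn h (ball 0 1))
    {γ : ℝ} (hγ : 0 ≤ γ) {r : ℝ} (hr : r < 1) (R : ℝ) :
    IntegrableOn (fun z => (R - ‖z‖ ^ 2) ^ γ * h z) (ball 0 r) μ := by
  have h1 : ContinuousOn (fun z : E => (R - ‖z‖ ^ 2) ^ γ * h z) (closedBall 0 r) :=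
    (ContinuousOn.rpow_const (by fun_prop) fun _ _ => .inr hγ).mul
      (hc.mono (closedBall_subset_ball hr))
  exact (h1.integrableOn_compact (isCompact_closedBall 0 r)).mono_set ball_subset_closedBall

/-- Fatou's lemma along radii increasing to 1. -/
theorem integrableOn_ball_of_setIntegral_le {h : E → ℝ} (hc : ContinuousOn h (ball 0 1))
    (h0 : ∀ z ∈ ball (0 : E) 1, 0 ≤ h z) {γ : ℝ} (hγ : 0 ≤ γ) {C : ℝ}
    (hC : ∀ r : ℝ, 1 / 2 ≤ r → r < 1 →
      ∫ z in ball 0 r, (r ^ 2 - ‖z‖ ^ 2) ^ γ * h z ∂μ ≤ C) :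
    IntegrableOn (fun z => (1 - ‖z‖ ^ 2) ^ γ * h z) (ball 0 1) μ := by
  -- The shift by 2 makes every radius at least `1 / 2`, including `k = 0`.
  set r : ℕ → ℝ := fun k => 1 - 1 / ((k : ℝ) + 2) with hr
  have hr2 : ∀ k, 1 / 2 ≤ r k := fun k => by
    have : 1 / ((k : ℝ) + 2) ≤ 1 / 2 := by gcongr; linarith [k.cast_nonneg (α := ℝ)]
    simp only [hr]
    linarith
  have hr1 : ∀ k, r k < 1 := fun k => by
    have : 0 < 1 / ((k : ℝ) + 2) := by positivity
    simp only [hr]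
    linarith
  have hrt : Tendsto r atTop (𝓝 1) := by
    have h1 : Tendsto (fun k : ℕ => (k : ℝ) + 2) atTop atTop :=
      tendsto_atTop_add_const_right _ _ tendsto_natCast_atTop_atTop
    simpa [hr] using (h1.inv_tendsto_atTop).const_sub 1
  set G : ℕ → E → ℝ := fun k => (ball 0 (r k)).indicator
    fun z => (r k ^ 2 - ‖z‖ ^ 2) ^ γ * h z with hG
  have hGi : ∀ k, Integrable (G k) μ := fun k =>
    (integrable_indicator_iff measurableSet_ball).2
      (integrableOn_sub_norm_sq_rpow_mul μ hc hγ (hr1 k) _)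
  have hG0 : ∀ k z, 0 ≤ G k z := fun k z => by
    refine Set.indicator_nonneg (fun z hz => ?_) z
    have hz1 := h0 z (ball_subset_ball (hr1 k).le hz)
    rw [mem_ball_zero_iff] at hz
    have : 0 ≤ r k ^ 2 - ‖z‖ ^ 2 := by nlinarith [norm_nonneg z]
    positivity
  have hlim : ∀ z ∈ ball (0 : E) 1,
      Tendsto (fun k => G k z) atTop (𝓝 ((1 - ‖z‖ ^ 2) ^ γ * h z)) := by
    intro z hz
    rw [mem_ball_zero_iff] at hz
    have h1 : Tendsto (fun k => (r k ^ 2 - ‖z‖ ^ 2) ^ γ * h z) atTop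
        (𝓝 ((1 - ‖z‖ ^ 2) ^ γ * h z)) := by
      have := (((hrt.pow 2).sub_const (‖z‖ ^ 2)).rpow_const (p := γ) (.inr hγ)).mul_const (h z)
      simpa using this
    refine h1.congr' ?_
    filter_upwards [hrt.eventually_const_lt hz] with k hk
    have hk' : z ∈ ball (0 : E) (r k) := mem_ball_zero_iff.2 hk
    simp only [hG, Set.indicator_of_mem hk']
  refine ⟨((ContinuousOn.rpow_const (by fun_prop) fun _ _ => .inr hγ).mul hc).aestronglyMeasurable
    measurableSet_ball, ?_⟩
  have hbound : ∀ k, ∫⁻ z in ball 0 1, ‖G k z‖ₑ ∂μ ≤ ENNReal.ofReal C := fun k => by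
    refine (setLIntegral_le_lintegral _ _).trans ?_
    rw [← ofReal_integral_norm_eq_lintegral_enorm (hGi k)]
    refine ENNReal.ofReal_le_ofReal ?_
    simp_rw [Real.norm_of_nonneg (hG0 k _)]
    rw [hG, integral_indicator measurableSet_ball]
    exact hC _ (hr2 k) (hr1 k)
  calc ∫⁻ z in ball 0 1, ‖(1 - ‖z‖ ^ 2) ^ γ * h z‖ₑ ∂μ
      = ∫⁻ z in ball 0 1, liminf (fun k => ‖G k z‖ₑ) atTop ∂μ :=
        setLIntegral_congr_fun measurableSet_ball fun z hz => (hlim z hz).enorm.liminf_eq.symm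
    _ ≤ liminf (fun k => ∫⁻ z in ball 0 1, ‖G k z‖ₑ ∂μ) atTop :=
        lintegral_liminf_le' fun k => (hGi k).aestronglyMeasurable.enorm.restrict
    _ ≤ ENNReal.ofReal C := liminf_le_of_frequently_le' (.of_forall hbound)
    _ < ⊤ := ENNReal.ofReal_lt_top

end Exhaustion

/-! ### The two implications for nonnegative subharmonic functions -/

section Characterization

variable {E : Type*} [NormedAddCommGroup E] [InnerProductSpace ℝ E] [FiniteDimensional ℝ E]
variable [MeasurableSpace E] [BorelSpace E] (μ : Measure E) [μ.IsAddHaarMeasure]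

/-- In Green's identity the subtracted term is nonnegative and can be dropped; then `‖z‖ ≤ 1` and `r
≤ 1` bound what is left. -/
theorem integrableOn_laplacian_of_integrableOn {u : E → ℝ} (hu : ContDiffOn ℝ 2 u (ball 0 1))
    (hu0 : ∀ z ∈ ball (0 : E) 1, 0 ≤ u z) (hΔ : ∀ z ∈ ball (0 : E) 1, 0 ≤ (Δ u) z)
    {α : ℝ} (hα : 2 ≤ α)
    (h : IntegrableOn (fun z => (1 - ‖z‖ ^ 2) ^ (α - 2) * u z) (ball 0 1) μ) :
    IntegrableOn (fun z => (1 - ‖z‖ ^ 2) ^ α * (Δ u) z) (ball 0 1) μ := by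
  refine integrableOn_ball_of_setIntegral_le μ (hu.continuousOn_laplacian isOpen_ball) hΔ
    (by linarith) (C := ∫ z in ball 0 1, 4 * α * (α - 1) * ((1 - ‖z‖ ^ 2) ^ (α - 2) * u z) ∂μ)
    fun r hr hr1 => ?_
  have hr0 : 0 ≤ r := by linarith
  have hα1 : 0 ≤ α - 1 := by linarith
  rw [setIntegral_rpow_mul_laplacian μ hr0 hr1 hu hα]
  have hC : IntegrableOn (fun z => 4 * α * (α - 1) * ((1 - ‖z‖ ^ 2) ^ (α - 2) * u z)) (ball 0 1) μ :=
    h.const_mul (4 * α * (α - 1))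
  have i1 := integrableOn_sub_norm_sq_rpow_mul μ (h := fun z => ‖z‖ ^ 2 * u z)
    ((by fun_prop : Continuous fun z : E => ‖z‖ ^ 2).continuousOn.mul hu.continuousOn)
    (γ := α - 2) (by linarith) hr1 (r ^ 2)
  have i2 := integrableOn_sub_norm_sq_rpow_mul μ hu.continuousOn (γ := α - 1) hα1 hr1 (r ^ 2)
  calc _ ≤ ∫ z in ball 0 r, 4 * α * (α - 1) * ((1 - ‖z‖ ^ 2) ^ (α - 2) * u z) ∂μ := by
        refine setIntegral_mono_on ?_ (hC.mono_set (ball_subset_ball hr1.le)) measurableSet_ball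
          fun z hz => ?_
        · refine ((i1.const_mul (4 * α * (α - 1))).sub
            (i2.const_mul (2 * α * Module.finrank ℝ E))).congr (.of_forall fun z => ?_)
          simp only [Pi.sub_apply]
          ring
        · have huz := hu0 z (ball_subset_ball hr1.le hz)
          rw [mem_ball_zero_iff] at hz
          have hn := norm_nonneg z
          have hs : 0 ≤ r ^ 2 - ‖z‖ ^ 2 := by nlinarith
          rw [← mul_assoc]
          refine mul_le_mul_of_nonneg_right ?_ huz
          have h1 : 4 * α * (α - 1) * ‖z‖ ^ 2 * (r ^ 2 - ‖z‖ ^ 2) ^ (α - 2) ≤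
              4 * α * (α - 1) * 1 * (1 - ‖z‖ ^ 2) ^ (α - 2) := by
            have : ‖z‖ ^ 2 ≤ 1 := by nlinarith
            have : r ^ 2 ≤ 1 := by nlinarith
            have : 0 ≤ α - 2 := by linarith
            gcongr
          have h2 : 0 ≤ 2 * α * Module.finrank ℝ E * (r ^ 2 - ‖z‖ ^ 2) ^ (α - 1) := by positivity
          linarith
    _ ≤ _ := by
        refine setIntegral_mono_set hC ?_ (ball_subset_ball hr1.le).eventuallyLE
        refine (ae_restrict_iff' measurableSet_ball).2 (.of_forall fun z hz => ?_)
        have huz := hu0 z hz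
        rw [mem_ball_zero_iff] at hz
        have hs : 0 ≤ 1 - ‖z‖ ^ 2 := by nlinarith [norm_nonneg z]
        show 0 ≤ 4 * α * (α - 1) * ((1 - ‖z‖ ^ 2) ^ (α - 2) * u z)
        positivity

/-- With `D = 4α(α-1)` and `c = D + 2αm`, the right side is `(r² - t²) ^ (α-2)` times `D r² - c (r²
- t²)`. The lower bound on `t²` makes this factor at least `D r² / 2`, which is at least 1 as `D ≥
8` and `r ≥ 1/2`. -/
theorem rpow_sub_two_le_of_mem_ball {α m r t : ℝ} (hα : 2 ≤ α) (hm : 0 ≤ m) (hr : 1 / 2 ≤ r)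
    (hr1 : r < 1) (ht0 : 0 ≤ t) (ht : t < r)
    (hρ : 1 - 4 * α * (α - 1) / (2 * (4 * α * (α - 1) + 2 * α * m)) < t ^ 2) :
    (r ^ 2 - t ^ 2) ^ (α - 2) ≤ 4 * α * (α - 1) * t ^ 2 * (r ^ 2 - t ^ 2) ^ (α - 2) -
      2 * α * m * (r ^ 2 - t ^ 2) ^ (α - 1) := by
  set D := 4 * α * (α - 1) with hD
  have hD8 : 8 ≤ D := by nlinarith
  set c := D + 2 * α * m with hc
  have hcD : D ≤ c := by nlinarith [mul_nonneg (show 0 ≤ α by linarith) hm]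
  have hc0 : 0 < c := by linarith
  have hs : 0 < r ^ 2 - t ^ 2 := by nlinarith
  have hpow : (r ^ 2 - t ^ 2) ^ (α - 1) = (r ^ 2 - t ^ 2) ^ (α - 2) * (r ^ 2 - t ^ 2) := by
    rw [← Real.rpow_add_one hs.ne']
    congr 1
    ring
  set P := (r ^ 2 - t ^ 2) ^ (α - 2) with hP
  have hP0 : 0 ≤ P := Real.rpow_nonneg hs.le _
  have h1 : D / (2 * c) * c = D / 2 := by field_simp
  have h2 : D / (2 * c) ≤ 1 := by
    rw [div_le_one (by positivity)]
    linarith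
  have hr2 : 1 / 4 ≤ r ^ 2 := by nlinarith
  have hr21 : r ^ 2 ≤ 1 := by nlinarith
  have h3 : r ^ 2 - t ^ 2 ≤ D / (2 * c) * r ^ 2 := by nlinarith
  have h4 : c * (r ^ 2 - t ^ 2) ≤ D / 2 * r ^ 2 := by
    calc c * (r ^ 2 - t ^ 2) ≤ c * (D / (2 * c) * r ^ 2) := by gcongr
      _ = D / 2 * r ^ 2 := by rw [← h1]; ring
  have h5 : 1 ≤ D * t ^ 2 - 2 * α * m * (r ^ 2 - t ^ 2) := by
    have : D * t ^ 2 - 2 * α * m * (r ^ 2 - t ^ 2) = D * r ^ 2 - c * (r ^ 2 - t ^ 2) := by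
      rw [hc]; ring
    rw [this]
    nlinarith
  rw [hpow]
  nlinarith

theorem integrableOn_of_integrableOn_laplacian {u : E → ℝ} (hu : ContDiffOn ℝ 2 u (ball 0 1))
    (hu0 : ∀ z ∈ ball (0 : E) 1, 0 ≤ u z) (hΔ : ∀ z ∈ ball (0 : E) 1, 0 ≤ (Δ u) z)
    {α : ℝ} (hα : 2 ≤ α)
    (h : IntegrableOn (fun z => (1 - ‖z‖ ^ 2) ^ α * (Δ u) z) (ball 0 1) μ) :
    IntegrableOn (fun z => (1 - ‖z‖ ^ 2) ^ (α - 2) * u z) (ball 0 1) μ := by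
  set m : ℝ := ((Module.finrank ℝ E : ℕ) : ℝ) with hm
  have hm0 : 0 ≤ m := by positivity
  have hα1 : 0 ≤ α - 1 := by linarith
  set D := 4 * α * (α - 1) with hD
  have hD8 : 8 ≤ D := by nlinarith
  set c := D + 2 * α * m with hc
  have hc0 : 0 < c := by positivity
  -- Beyond this radius, independent of `r`, the kernel dominates `(r² - ‖z‖²) ^ (α-2)`.
  set ρ := √(1 - D / (2 * c)) with hρ
  have hρ1 : ρ < 1 := by
    rw [hρ, Real.sqrt_lt' one_pos]
    have : 0 < D / (2 * c) := by positivity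
    linarith
  have hB : IntegrableOn u (closedBall 0 ρ) μ :=
    (hu.continuousOn.mono (closedBall_subset_ball hρ1)).integrableOn_compact
      (isCompact_closedBall 0 ρ)
  set B : E → ℝ := (closedBall (0 : E) ρ).indicator u with hBdef
  have hBi : Integrable B μ := (integrable_indicator_iff measurableSet_closedBall).2 hB
  have hB0 : ∀ z, 0 ≤ B z := fun z =>
    Set.indicator_nonneg (fun z hz => hu0 z (closedBall_subset_ball hρ1 hz)) z
  refine integrableOn_ball_of_setIntegral_le μ hu.continuousOn hu0 (by linarith)
    -- Inside radius `ρ` the kernel is at least `-2αm` and the target weight at most 1, so adding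
    -- `(1 + 2αm) u` there restores the pointwise inequality.
    (C := ∫ z in ball 0 1, (1 - ‖z‖ ^ 2) ^ α * (Δ u) z ∂μ + (1 + 2 * α * m) * ∫ z, B z ∂μ)
    fun r hr hr1 => ?_
  have hr0 : 0 ≤ r := by linarith
  have hr21 : r ^ 2 ≤ 1 := by nlinarith
  have hΔc := hu.continuousOn_laplacian isOpen_ball
  have i1 := integrableOn_sub_norm_sq_rpow_mul μ (h := fun z => ‖z‖ ^ 2 * u z)
    ((by fun_prop : Continuous fun z : E => ‖z‖ ^ 2).continuousOn.mul hu.continuousOn)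
    (γ := α - 2) (by linarith) hr1 (r ^ 2)
  have i2 := integrableOn_sub_norm_sq_rpow_mul μ hu.continuousOn (γ := α - 1) hα1 hr1 (r ^ 2)
  have i3 := integrableOn_sub_norm_sq_rpow_mul μ hu.continuousOn (γ := α - 2) (by linarith) hr1
    (r ^ 2)
  have i4 := integrableOn_sub_norm_sq_rpow_mul μ hΔc (γ := α) (by linarith) hr1 (r ^ 2)
  have iK : IntegrableOn (fun z => (D * ‖z‖ ^ 2 * (r ^ 2 - ‖z‖ ^ 2) ^ (α - 2) -
      2 * α * m * (r ^ 2 - ‖z‖ ^ 2) ^ (α - 1)) * u z) (ball 0 r) μ := by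
    refine ((i1.const_mul D).sub (i2.const_mul (2 * α * m))).congr (.of_forall fun z => ?_)
    simp only [Pi.sub_apply]
    ring
  have hpt : ∀ z ∈ ball (0 : E) r, (r ^ 2 - ‖z‖ ^ 2) ^ (α - 2) * u z ≤
      (D * ‖z‖ ^ 2 * (r ^ 2 - ‖z‖ ^ 2) ^ (α - 2) -
        2 * α * m * (r ^ 2 - ‖z‖ ^ 2) ^ (α - 1)) * u z + (1 + 2 * α * m) * B z := by
    intro z hz
    have huz := hu0 z (ball_subset_ball hr1.le hz)
    rw [mem_ball_zero_iff] at hz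
    have hn := norm_nonneg z
    by_cases hzρ : z ∈ closedBall (0 : E) ρ
    · rw [hBdef, Set.indicator_of_mem hzρ, ← add_mul]
      refine mul_le_mul_of_nonneg_right ?_ huz
      have hs0 : 0 ≤ r ^ 2 - ‖z‖ ^ 2 := by nlinarith
      have hs1 : r ^ 2 - ‖z‖ ^ 2 ≤ 1 := by nlinarith
      have h1 := Real.rpow_le_one hs0 hs1 (show 0 ≤ α - 2 by linarith)
      have h2 : 2 * α * m * (r ^ 2 - ‖z‖ ^ 2) ^ (α - 1) ≤ 2 * α * m :=
        mul_le_of_le_one_right (by positivity) (Real.rpow_le_one hs0 hs1 hα1)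
      have h3 : 0 ≤ D * ‖z‖ ^ 2 * (r ^ 2 - ‖z‖ ^ 2) ^ (α - 2) := by positivity
      linarith
    · refine le_add_of_le_of_nonneg (mul_le_mul_of_nonneg_right ?_ huz)
        (mul_nonneg (by positivity) (hB0 z))
      rw [mem_closedBall_zero_iff, not_le] at hzρ
      exact rpow_sub_two_le_of_mem_ball hα hm0 hr hr1 hn hz (Real.lt_sq_of_sqrt_lt hzρ)
  calc ∫ z in ball 0 r, (r ^ 2 - ‖z‖ ^ 2) ^ (α - 2) * u z ∂μ
      ≤ ∫ z in ball 0 r, ((D * ‖z‖ ^ 2 * (r ^ 2 - ‖z‖ ^ 2) ^ (α - 2) -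
        2 * α * m * (r ^ 2 - ‖z‖ ^ 2) ^ (α - 1)) * u z + (1 + 2 * α * m) * B z) ∂μ :=
        setIntegral_mono_on i3 (iK.add (hBi.integrableOn.const_mul _)) measurableSet_ball hpt
    _ = ∫ z in ball 0 r, (r ^ 2 - ‖z‖ ^ 2) ^ α * (Δ u) z ∂μ +
        (1 + 2 * α * m) * ∫ z in ball 0 r, B z ∂μ := by
        rw [integral_add iK (hBi.integrableOn.const_mul _), integral_const_mul,
          setIntegral_rpow_mul_laplacian μ hr0 hr1 hu hα]
    _ ≤ _ := by
        refine add_le_add ?_ (mul_le_mul_of_nonneg_left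
          (setIntegral_le_integral hBi (.of_forall hB0)) (by positivity))
        calc ∫ z in ball 0 r, (r ^ 2 - ‖z‖ ^ 2) ^ α * (Δ u) z ∂μ
            ≤ ∫ z in ball 0 r, (1 - ‖z‖ ^ 2) ^ α * (Δ u) z ∂μ := by
              refine setIntegral_mono_on i4 (h.mono_set (ball_subset_ball hr1.le))
                measurableSet_ball fun z hz => ?_
              have hz1 := hΔ z (ball_subset_ball hr1.le hz)
              rw [mem_ball_zero_iff] at hz
              have hs0 : 0 ≤ r ^ 2 - ‖z‖ ^ 2 := by nlinarith [norm_nonneg z]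
              gcongr
          _ ≤ ∫ z in ball 0 1, (1 - ‖z‖ ^ 2) ^ α * (Δ u) z ∂μ := by
              refine setIntegral_mono_set h ?_ (ball_subset_ball hr1.le).eventuallyLE
              refine (ae_restrict_iff' measurableSet_ball).2 (.of_forall fun z hz => ?_)
              have hz1 := hΔ z hz
              rw [mem_ball_zero_iff] at hz
              have hs : 0 ≤ 1 - ‖z‖ ^ 2 := by nlinarith [norm_nonneg z]
              show 0 ≤ (1 - ‖z‖ ^ 2) ^ α * (Δ u) z
              positivity

end Characterization

/-! ### Distance to the boundary and the Bergman-type space -/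

section Ball

/-- On the ball, `1 - ‖z‖ ≤ 1 - ‖z‖² ≤ 2 (1 - ‖z‖)`. -/
theorem integrableOn_one_sub_norm_sq_rpow_iff {E : Type*} [NormedAddCommGroup E]
    [MeasurableSpace E] [BorelSpace E] (μ : Measure E) {h : E → ℝ}
    (hc : ContinuousOn h (ball 0 1)) {γ : ℝ} (hγ : 0 ≤ γ) :
    IntegrableOn (fun z => (1 - ‖z‖ ^ 2) ^ γ * h z) (ball 0 1) μ ↔
      IntegrableOn (fun z => (1 - ‖z‖) ^ γ * h z) (ball 0 1) μ := by
  have hm1 : AEStronglyMeasurable (fun z => (1 - ‖z‖ ^ 2) ^ γ * h z) (μ.restrict (ball 0 1)) :=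
    ((ContinuousOn.rpow_const (by fun_prop) fun _ _ => .inr hγ).mul hc).aestronglyMeasurable
      measurableSet_ball
  have hm2 : AEStronglyMeasurable (fun z => (1 - ‖z‖) ^ γ * h z) (μ.restrict (ball 0 1)) :=
    ((ContinuousOn.rpow_const (by fun_prop) fun _ _ => .inr hγ).mul hc).aestronglyMeasurable
      measurableSet_ball
  constructor
  · intro hi
    refine Integrable.mono hi hm2 ((ae_restrict_iff' measurableSet_ball).2 (.of_forall fun z hz => ?_))
    rw [mem_ball_zero_iff] at hz
    have hn := norm_nonneg z
    have h1 : 0 ≤ 1 - ‖z‖ := by linarith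
    have h2 : 1 - ‖z‖ ≤ 1 - ‖z‖ ^ 2 := by nlinarith
    rw [norm_mul, norm_mul, Real.norm_of_nonneg (Real.rpow_nonneg h1 _),
      Real.norm_of_nonneg (Real.rpow_nonneg (h1.trans h2) _)]
    gcongr
  · intro hi
    refine (hi.const_mul (2 ^ γ)).mono hm1
      ((ae_restrict_iff' measurableSet_ball).2 (.of_forall fun z hz => ?_))
    rw [mem_ball_zero_iff] at hz
    have hn := norm_nonneg z
    have h1 : 0 ≤ 1 - ‖z‖ := by linarith
    have h2 : 0 ≤ 1 - ‖z‖ ^ 2 := by nlinarith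
    have h3 : 1 - ‖z‖ ^ 2 ≤ 2 * (1 - ‖z‖) := by nlinarith
    rw [← mul_assoc, ← Real.mul_rpow zero_le_two h1, norm_mul, norm_mul,
      Real.norm_of_nonneg (Real.rpow_nonneg h2 _),
      Real.norm_of_nonneg (Real.rpow_nonneg (h2.trans h3) _)]
    gcongr

theorem distToBoundary_eq {n : ℕ} (hn : 1 ≤ n) {z : EuclideanSpace ℂ (Fin n)}
    (hz : z ∈ ball (0 : EuclideanSpace ℂ (Fin n)) 1) : distToBoundary z = 1 - ‖z‖ := by
  rw [mem_ball_zero_iff] at hz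
  rw [distToBoundary, frontier_ball _ one_ne_zero]
  obtain ⟨e, he, hze⟩ : ∃ e : EuclideanSpace ℂ (Fin n), ‖e‖ = 1 ∧ z = (‖z‖ : ℂ) • e := by
    rcases eq_or_ne z 0 with rfl | h0
    -- The centre has no preferred direction; any unit vector serves, and one exists because `n ≥
    -- 1`.
    · exact ⟨EuclideanSpace.single ⟨0, hn⟩ 1, by simp, by simp⟩
    · have : (‖z‖ : ℂ) ≠ 0 := by simpa using h0
      refine ⟨(‖z‖ : ℂ)⁻¹ • z, ?_, ?_⟩
      · rw [norm_smul, norm_inv, Complex.norm_real, norm_norm,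
          inv_mul_cancel₀ (norm_ne_zero_iff.2 h0)]
      · rw [smul_inv_smul₀ this]
  have hes : e ∈ sphere (0 : EuclideanSpace ℂ (Fin n)) 1 := by simpa using he
  refine le_antisymm ?_ ((le_infDist ⟨e, hes⟩).2 fun y hy => ?_)
  · refine (infDist_le_dist_of_mem hes).trans_eq ?_
    have h1 : e - z = ((1 - ‖z‖ : ℝ) : ℂ) • e := by
      conv_lhs => rw [hze]
      push_cast
      rw [sub_smul, one_smul]
    rw [dist_comm, dist_eq_norm, h1, norm_smul, he, mul_one, Complex.norm_real,
      Real.norm_of_nonneg (by linarith)]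
  · rw [mem_sphere_zero_iff_norm] at hy
    rw [dist_comm, dist_eq_norm, ← hy]
    exact norm_sub_norm_le y z

theorem integrable_normalizedBallVolume_iff {n : ℕ} {h : EuclideanSpace ℂ (Fin n) → ℝ} :
    Integrable h (normalizedBallVolume n) ↔ IntegrableOn h (ball 0 1) volume :=
  integrable_smul_measure (ENNReal.inv_ne_zero.2 measure_ball_lt_top.ne)
    (ENNReal.inv_ne_top.2 (measure_ball_pos _ _ one_pos).ne')

/-- The term at the origin is always finite, and neither the normalizing constant nor the outer
power affects finiteness. -/
theorem memBergman_iff {n : ℕ} (hn : 1 ≤ n) {f : EuclideanSpace ℂ (Fin n) → ℂ}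
    (hf : ContinuousOn f (ball 0 1)) {ν p : ℝ} (hν : 0 ≤ ν) (hp : 0 < p) :
    MemBergman ν p f ↔ IntegrableOn (fun z => (1 - ‖z‖) ^ ν * ‖f z‖ ^ p) (ball 0 1) volume := by
  have hm : AEStronglyMeasurable (fun z => (1 - ‖z‖) ^ ν * ‖f z‖ ^ p)
      (volume.restrict (ball (0 : EuclideanSpace ℂ (Fin n)) 1)) :=
    ((ContinuousOn.rpow_const (by fun_prop) fun _ _ => .inr hν).mul
      (hf.norm.rpow_const fun _ _ => .inr hp.le)).aestronglyMeasurable measurableSet_ball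
  have h0 : 0 ≤ᵐ[volume.restrict (ball (0 : EuclideanSpace ℂ (Fin n)) 1)]
      fun z => (1 - ‖z‖) ^ ν * ‖f z‖ ^ p := by
    refine (ae_restrict_iff' measurableSet_ball).2 (.of_forall fun z hz => ?_)
    rw [mem_ball_zero_iff] at hz
    have : 0 ≤ 1 - ‖z‖ := by linarith
    show 0 ≤ (1 - ‖z‖) ^ ν * ‖f z‖ ^ p
    positivity
  have hE : bergmanEnergy f ν p =
      (volume (ball (0 : EuclideanSpace ℂ (Fin n)) 1))⁻¹ *
        ∫⁻ z in ball 0 1, ENNReal.ofReal ((1 - ‖z‖) ^ ν * ‖f z‖ ^ p) := by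
    rw [bergmanEnergy, normalizedBallVolume, lintegral_smul_measure, smul_eq_mul]
    congr 1
    exact setLIntegral_congr_fun measurableSet_ball fun z hz => by
      simp only [distToBoundary_eq hn hz]
  have hc0 : (volume (ball (0 : EuclideanSpace ℂ (Fin n)) 1))⁻¹ ≠ 0 :=
    ENNReal.inv_ne_zero.2 measure_ball_lt_top.ne
  have hct : (volume (ball (0 : EuclideanSpace ℂ (Fin n)) 1))⁻¹ ≠ ⊤ :=
    ENNReal.inv_ne_top.2 (measure_ball_pos _ _ one_pos).ne'
  rw [MemBergman, bergmanNorm, and_iff_right hf, ENNReal.add_lt_top, and_iff_right enorm_lt_top,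
    ENNReal.rpow_lt_top_iff_of_pos (one_div_pos.2 hp), hE, IntegrableOn, Integrable,
    and_iff_right hm, hasFiniteIntegral_iff_ofReal h0]
  constructor
  · intro h
    exact ENNReal.lt_top_of_mul_ne_top_right h.ne hc0
  · exact fun h => ENNReal.mul_lt_top hct.lt_top h

end Ball

theorem mainTheorem9 (n : ℕ) (hn : 1 ≤ n)
    (τ η : EuclideanSpace ℂ (Fin n) → ℝ)
    (hτ : ContinuousOn τ (ball 0 1)) (hτ_nonneg : ∀ z ∈ ball 0 1, 0 ≤ τ z)
    (hη : ContinuousOn η (ball 0 1)) (hη_nonneg : ∀ z ∈ ball 0 1, 0 ≤ η z)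
    (f : EuclideanSpace ℂ (Fin n) → ℂ)
    (hf : ContDiffOn ℝ 2 f (ball 0 1)) (hY : SolvesYukawa τ η f)
    (p α : ℝ) (hp : 2 ≤ p) (hα : 2 ≤ α) :
    Integrable (fun z : EuclideanSpace ℂ (Fin n) =>
        (1 - ‖z‖ ^ 2) ^ α * (Δ (fun w : EuclideanSpace ℂ (Fin n) => ‖f w‖ ^ p)) z)
      (normalizedBallVolume n) ↔
    MemBergman (α - 2) p f := by
  have hα0 : 0 ≤ α - 2 := by linarith
  have hu : ContDiffOn ℝ 2 (fun w : EuclideanSpace ℂ (Fin n) => ‖f w‖ ^ p) (ball 0 1) :=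
    (contDiff_two_norm_rpow hp).comp_contDiffOn hf
  have hu0 : ∀ z ∈ ball (0 : EuclideanSpace ℂ (Fin n)) 1, 0 ≤ ‖f z‖ ^ p :=
    fun z _ => by positivity
  have hΔ : ∀ z ∈ ball (0 : EuclideanSpace ℂ (Fin n)) 1,
      0 ≤ (Δ (fun w : EuclideanSpace ℂ (Fin n) => ‖f w‖ ^ p)) z := by
    refine fun z hz => laplacian_norm_rpow_nonneg isOpen_ball hf (fun y hy => ?_) hp hz
    have h1 := hτ_nonneg y hy
    have h2 := hη_nonneg y hy
    -- Pairing the equation with `f` in the real inner product of `ℂ` turns `Re f` into `(Re f)²`;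
    -- this is the only use of the equation.
    have h3 : ⟪f y, (Δ f) y⟫ =
        τ y * ((f y).re ^ 2 + (f y).im ^ 2) + η y * (f y).re ^ 2 := by
      rw [hY y hy, Complex.inner]
      simp
      ring
    rw [h3]
    positivity
  rw [integrable_normalizedBallVolume_iff, memBergman_iff hn hf.continuousOn hα0 (by linarith),
    ← integrableOn_one_sub_norm_sq_rpow_iff volume hu.continuousOn hα0]
  exact ⟨integrableOn_of_integrableOn_laplacian volume hu hu0 hΔ hα,
    integrableOn_laplacian_of_integrableOn volume hu hu0 hΔ hα⟩
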